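/- Setting. Let $n_t,n_r\ge 0$ and $T\ge 1$ be integers and $n_{\min}=\min\{n_t,n_r\}$. Consider the quasi-static Rayleigh channel $\mathbf Y=\mathbf H\mathbf X+\mathbf N$ with $\mathbf H\in\mathbb C^{n_r\times n_t}$ and $\mathbf N\in\mathbb C^{n_r\times T}$ independent, each with i.i.d. $\mathcal{CN}(0,1)$ entries, and with $\mathbf H$ known to the receiver. A space-time block code (STBC) is a finite set of $n_t\times T$ complex matrices; its codewords are equally likely to be sent and are decoded by maximum likelihood. A linear STBC (LSTBC) is an STBC of the form $\bigl\{\sum_{i=1}^k(s_{iI}\mathbf A_{iI}+s_{iQ}\mathbf A_{iQ}) : (s_{1I},s_{1Q},\dots,s_{kI},s_{kQ})\in\mathcal A\bigr\}$ with weight matrices $\mathbf A_{iI},\mathbf A_{iQ}\in\mathbb C^{n_t\times T}$ and a finite $\mathcal A\subset\mathbb R^{2k}$; its generator matrix $\mathbf G\in\mathbb R^{2Tn_t\times 2k}$ has as columns the vectorized weight matrices, written out in real and imaginary parts, and its code-rate is $\operatorname{rank}(\mathbf G)/(2T)$ complex dimensions per channel use. A rate-$p$ LSTBC-scheme is a family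 $\{\mathcal X(SNR)\}_{SNR>0}$ of LSTBCs of block length $T$, all of code-rate $p$. It is assumed to satisfy the power constraint $\frac1{|\mathcal X(SNR)|}\sum_{\mathbf X\in\mathcal X(SNR)}\|\mathbf X\|^2\ \dot\le\ SNR$, meaning that for each $\delta>0$ the left side is at most $SNR^{1+\delta}$ for all large $SNR$ (which holds in particular if the average energy is equal to, or at most, $T\,SNR$). With all logarithms to base 2, its multiplexing gain is $r=\lim_{SNR\to\infty}\frac{\log|\mathcal X(SNR)|}{T\log SNR}$, and its diversity gain is $-\lim_{SNR\to\infty}\frac{\log P_e(SNR)}{\log SNR}$, where $P_e(SNR)$ is the probability of codeword error. Let $d^*$ be the piecewise-linear function on $[0,n_{\min}]$ connecting the points $(k,(n_t-k)(n_r-k))$, $k=0,1,\dots,n_{\min}$. A collection of schemes $(\mathcal X_r)_{r\in[0,n_{\min}]}$ is DMT-optimal if, for every $r\in[0,n_{\min}]$, $\mathcal X_r$ has multiplexing gain $r$ and diversity gain $d^*(r)$. Lemma. Let $p<n_{\min}$. (i) If a rate-$p$ LSTBC-scheme satisfying the power constraint has multiplexing gain $r>p$, then there is $c>0$ with $P_e(SNR)\ge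 c$ for all sufficiently large $SNR$; its diversity gain is $0$, whereas $d^*(r)>0$ if $r<n_{\min}$. (ii) Consequently rate-$p$ LSTBC-schemes are not DMT-optimal: no collection $(\mathcal X_r)_{r\in[0,n_{\min}]}$ of rate-$p$ LSTBC-schemes satisfying the power constraint is DMT-optimal. -/

import Mathlib

open Filter Topology MeasureTheory ProbabilityTheory

noncomputable section

namespace MIMO

/-- The law `CN(0,1)` on `ℂ`: independent real and imaginary parts, each `N(0, 1/2)`, so that the
total variance is one. -/
def stdComplexGaussian : Measure ℂ :=
  ((gaussianReal 0 (1 / 2)).prod (gaussianReal 0 (1 / 2))).map fun z : ℝ × ℝ => ⟨z.1, z.2⟩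

/-- The law of an `m × n` complex matrix with i.i.d. `CN(0,1)` entries, as a measure on arrays
`Fin m → Fin n → ℂ`. -/
def gaussianMatrix (m n : ℕ) : Measure (Fin m → Fin n → ℂ) :=
  Measure.pi fun _ => Measure.pi fun _ => stdComplexGaussian

/-- Squared Frobenius norm. -/
def frobSq {m n : ℕ} (X : Matrix (Fin m) (Fin n) ℂ) : ℝ :=
  ∑ i, ∑ j, ‖X i j‖ ^ 2

/-- `f(x) ≤̇ x ^ b`: for every `δ > 0`, `f x ≤ x ^ (b + δ)` for all large `x`; for positive `f` this
is `limsup (log f x / log x) ≤ b`. -/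
def DotLE (f : ℝ → ℝ) (b : ℝ) : Prop :=
  ∀ δ > 0, ∀ᶠ x in atTop, f x ≤ x ^ (b + δ)

/-- A space-time block code for `nt` transmit antennas and block length `T`: a finite set of
`nt × T` complex matrices. -/
abbrev STBC (nt T : ℕ) := Finset (Matrix (Fin nt) (Fin T) ℂ)

namespace STBC

variable {nt T : ℕ}

/-- Bit rate `(1/T) log₂ |𝒳|` in bits per channel use. -/
def bitRate (C : STBC nt T) : ℝ := Real.logb 2 (C.card : ℝ) / (T : ℝ)

/-- Average energy `(1/|𝒳|) ∑ ‖X‖²` of a codeword, all codewords being equally likely. -/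
def avgEnergy (C : STBC nt T) : ℝ := (∑ X ∈ C, frobSq X) / (C.card : ℝ)

/-- The event that maximum-likelihood decoding with known channel fails when `X` is sent: the pairs
`(H, N)` for which, with `Y = H X + N`, some codeword `X'` is strictly more likely than `X`, that is
`‖Y - H X'‖ < ‖Y - H X‖`. -/
def errorEvent (nr : ℕ) (C : STBC nt T) (X : Matrix (Fin nt) (Fin T) ℂ) :
    Set ((Fin nr → Fin nt → ℂ) × (Fin nr → Fin T → ℂ)) :=
  {ω | ∃ X' ∈ C,
    frobSq ((Matrix.of ω.1 * X + Matrix.of ω.2) - Matrix.of ω.1 * X') <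
      frobSq ((Matrix.of ω.1 * X + Matrix.of ω.2) - Matrix.of ω.1 * X)}

/-- Probability of codeword error over the quasi-static Rayleigh channel with `nr` receive antennas:
the channel matrix and the noise matrix are independent, each with i.i.d. `CN(0,1)` entries, and
the codewords are equally likely. -/
def errorProb (nr : ℕ) (C : STBC nt T) : ℝ :=
  (∑ X ∈ C, ((gaussianMatrix nr nt).prod (gaussianMatrix nr T)).real (C.errorEvent nr X)) /
    (C.card : ℝ)

end STBC

/-- An STBC-scheme: a family of STBCs of block length `T` indexed by the signal-to-noise ratio. -/
abbrev STBCScheme (nt T : ℕ) := ℝ → STBC nt T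

namespace STBCScheme

variable {nt T : ℕ}

/-- Power constraint: the average codeword energy is `≤̇ SNR`. It holds if the average energy equals
(or is at most) `T * SNR`, and also if every codeword satisfies `‖X‖² ≤̇ SNR` uniformly. -/
def PowerConstraint (S : STBCScheme nt T) : Prop :=
  DotLE (fun snr => (S snr).avgEnergy) 1

/-- The multiplexing gain is `r`: `R(SNR) / log SNR → r`. -/
def HasMultiplexingGain (S : STBCScheme nt T) (r : ℝ) : Prop :=
  Tendsto (fun snr => (S snr).bitRate / Real.logb 2 snr) atTop (𝓝 r)

/-- With `nr` receive antennas the diversity gain is `d`: `- log P_e(SNR) / log SNR → d`, where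
`P_e(SNR)` has to be positive for large `SNR` for its logarithm to make sense. -/
def HasDiversityGain (nr : ℕ) (S : STBCScheme nt T) (d : ℝ) : Prop :=
  (∀ᶠ snr in atTop, 0 < (S snr).errorProb nr) ∧
    Tendsto (fun snr => -(Real.logb 2 ((S snr).errorProb nr) / Real.logb 2 snr)) atTop (𝓝 d)

end STBCScheme

/-- The corner values `d(k) = (nt - k) (nr - k)`. -/
def dmtCorner (nt nr k : ℕ) : ℝ := ((nt : ℝ) - k) * ((nr : ℝ) - k)

/-- The optimal DMT curve on `[0, min nt nr]`: the piecewise-linear function that connects the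
points `(k, d(k))`, `k = 0, …, min nt nr`. -/
def optimalDMT (nt nr : ℕ) (r : ℝ) : ℝ :=
  dmtCorner nt nr ⌊r⌋₊ +
    (r - ⌊r⌋₊) * (dmtCorner nt nr (⌊r⌋₊ + 1) - dmtCorner nt nr ⌊r⌋₊)

/-- DMT-optimality for `nr` receive antennas. To speak of a whole curve `r ↦ d(r)` one needs a scheme
at each multiplexing gain, so the argument assigns to each `r` a scheme `S r`; DMT-optimal means
that for every `r ∈ [0, min nt nr]` the scheme `S r` has multiplexing gain `r` and its diversity
gain is the optimal one. -/
def IsDMTOptimal {nt T : ℕ} (nr : ℕ) (S : ℝ → STBCScheme nt T) : Prop :=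
  ∀ r ∈ Set.Icc (0 : ℝ) ((min nt nr : ℕ) : ℝ),
    (S r).HasMultiplexingGain r ∧ (S r).HasDiversityGain nr (optimalDMT nt nr r)

/-- A linear STBC, given by `2 k` weight matrices and a finite constellation in `ℝ^(2 k)`. The index
`(i, 0)` stands for the in-phase symbol `s_{iI}` and `(i, 1)` for the quadrature symbol `s_{iQ}`. -/
structure LSTBC (nt T : ℕ) where
  k : ℕ
  weight : Fin k × Fin 2 → Matrix (Fin nt) (Fin T) ℂ
  constellation : Finset (Fin k × Fin 2 → ℝ)

/-- `x ↦ x̃`: the real vector of the real and imaginary parts of a complex vector. -/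
def tilde {ι : Type*} (x : ι → ℂ) : ι × Fin 2 → ℝ :=
  fun q => ![(x q.1).re, (x q.1).im] q.2

namespace LSTBC

variable {nt T : ℕ}

open Classical in
/-- The codewords `∑ i, (s_{iI} A_{iI} + s_{iQ} A_{iQ})`, with `s` in the constellation. -/
def code (L : LSTBC nt T) : STBC nt T :=
  L.constellation.image fun s => ∑ j, (s j : ℂ) • L.weight j

/-- The generator matrix, whose columns are the real vectors of the vectorized weight matrices. -/
def generator (L : LSTBC nt T) : Matrix ((Fin T × Fin nt) × Fin 2) (Fin L.k × Fin 2) ℝ :=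
  Matrix.of fun q j => tilde (Matrix.vec (L.weight j)) q

/-- Code-rate in complex dimensions per channel use. -/
def codeRate (L : LSTBC nt T) : ℝ := (L.generator.rank : ℝ) / (2 * (T : ℝ))

end LSTBC

/-- An LSTBC-scheme: a family of LSTBCs of block length `T` indexed by the signal-to-noise ratio. -/
abbrev LSTBCScheme (nt T : ℕ) := ℝ → LSTBC nt T

namespace LSTBCScheme

variable {nt T : ℕ}

/-- The underlying STBC-scheme. -/
def toSTBCScheme (L : LSTBCScheme nt T) : STBCScheme nt T := fun snr => (L snr).code

/-- A rate-`p` LSTBC-scheme: all its LSTBCs have code-rate `p`. -/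
def IsRate (L : LSTBCScheme nt T) (p : ℝ) : Prop := ∀ snr > 0, (L snr).codeRate = p

end LSTBCScheme

end MIMO

end

/-!
The codewords of a linear code of code-rate `p` lie in the real span of the weight matrices, a space
of dimension `2 T p`, and by Markov's inequality at least half of them have energy at most twice the
average, hence at most `2 SNR ^ (1 + δ)`. A volume comparison shows that a ball of that size holds
at most about `SNR ^ (T p (1 + δ))` points at mutual distance at least one
(`card_le_of_separated_of_subset_submodule`). A multiplexing gain `r > p` forces about `SNR ^ (T r)`
codewords, far more than that, so that at least a quarter of the codewords have another codeword
within Frobenius distance one (`half_card_sub_le_card_filter_neighbour`).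

A codeword `X` with such a neighbour `X'` is decoded wrongly with probability at least a constant
`c > 0` (`exists_le_measure_confusionEvent`). With `U = X - X'`, the decoder prefers `X'` as soon as
`‖H U + N‖ < ‖N‖`. By convexity this event only grows when `U` is scaled down, so it suffices to
treat `‖U‖ = 1`. There the event is open jointly in `(U, H, N)` and never empty, the Gaussian law
charges every nonempty open set, and the unit sphere is compact.

Hence the error probability is at least `c / 4` for large `SNR`, and the diversity gain is zero,
while the optimal curve is positive to the left of `min nt nr` (`optimalDMT_pos`). A DMT-optimal
collection would contain a scheme with multiplexing gain strictly between `p` and `min nt nr`, whose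
diversity gain would have both values.
-/

namespace MIMO

/-! ### The Gaussian laws charge every nonempty open set -/

instance : IsProbabilityMeasure stdComplexGaussian := by
  unfold stdComplexGaussian
  exact Measure.isProbabilityMeasure_map
    Complex.equivRealProdCLM.symm.continuous.measurable.aemeasurable

lemma isOpenPosMeasure_gaussianReal (m : ℝ) {v : NNReal} (hv : v ≠ 0) :
    (gaussianReal m v).IsOpenPosMeasure :=
  (gaussianReal_absolutelyContinuous' m hv).isOpenPosMeasure

instance : stdComplexGaussian.IsOpenPosMeasure := by
  have := isOpenPosMeasure_gaussianReal 0 (v := 1 / 2) (by norm_num)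
  exact Complex.equivRealProdCLM.symm.continuous.isOpenPosMeasure_map
    Complex.equivRealProdCLM.symm.surjective

instance (m n : ℕ) : IsProbabilityMeasure (gaussianMatrix m n) := by
  unfold gaussianMatrix; infer_instance

instance (m n : ℕ) : (gaussianMatrix m n).IsOpenPosMeasure := by
  unfold gaussianMatrix; infer_instance

/-! ### Confusing two codewords -/

section Frob

variable {m n : ℕ}

lemma frobSq_nonneg (X : Matrix (Fin m) (Fin n) ℂ) : 0 ≤ frobSq X := by
  unfold frobSq; positivity

lemma frobSq_eq_zero {X : Matrix (Fin m) (Fin n) ℂ} : frobSq X = 0 ↔ X = 0 := by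
  constructor
  · intro h
    ext i j
    have h1 := (Finset.sum_eq_zero_iff_of_nonneg (fun i _ => by positivity)).1 h i
      (Finset.mem_univ i)
    have h2 := (Finset.sum_eq_zero_iff_of_nonneg (fun j _ => by positivity)).1 h1 j
      (Finset.mem_univ j)
    simpa using h2
  · rintro rfl
    simp [frobSq]

lemma frobSq_pos {X : Matrix (Fin m) (Fin n) ℂ} (hX : X ≠ 0) : 0 < frobSq X :=
  (frobSq_nonneg X).lt_of_ne fun h => hX (frobSq_eq_zero.1 h.symm)

lemma frobSq_smul (t : ℝ) (X : Matrix (Fin m) (Fin n) ℂ) :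
    frobSq (t • X) = t ^ 2 * frobSq X := by
  simp [frobSq, Finset.mul_sum, mul_pow]

lemma frobSq_neg (X : Matrix (Fin m) (Fin n) ℂ) : frobSq (-X) = frobSq X := by
  simp [frobSq]

lemma continuous_frobSq : Continuous (frobSq : Matrix (Fin m) (Fin n) ℂ → ℝ) := by
  unfold frobSq; fun_prop

lemma isCompact_frobSq_eq_one : IsCompact {X : Matrix (Fin m) (Fin n) ℂ | frobSq X = 1} := by
  have hK : IsCompact (Set.univ.pi fun _ : Fin m => Set.univ.pi fun _ : Fin n =>
      Metric.closedBall (0 : ℂ) 1) :=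
    isCompact_univ_pi fun _ => isCompact_univ_pi fun _ => isCompact_closedBall 0 1
  refine IsCompact.of_isClosed_subset (X := Matrix (Fin m) (Fin n) ℂ) hK
    (isClosed_eq continuous_frobSq continuous_const) fun X hX i _ j _ => ?_
  have h1 : ‖X i j‖ ^ 2 ≤ ∑ j, ‖X i j‖ ^ 2 :=
    Finset.single_le_sum (f := fun j => ‖X i j‖ ^ 2) (fun _ _ => by positivity)
      (Finset.mem_univ j)
  have h2 : ∑ j, ‖X i j‖ ^ 2 ≤ frobSq X :=
    Finset.single_le_sum (f := fun i => ∑ j, ‖X i j‖ ^ 2) (fun _ _ => by positivity)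
      (Finset.mem_univ i)
  have h3 : ‖X i j‖ ^ 2 ≤ 1 ^ 2 := by
    rw [Set.mem_ofPred_eq] at hX
    linarith
  simpa using (sq_le_sq₀ (norm_nonneg _) zero_le_one).1 h3

/-- Convexity of the squared Frobenius norm along a segment issuing from `N`. -/
lemma frobSq_smul_add_lt {t : ℝ} (ht0 : 0 < t) (ht1 : t ≤ 1) {A N : Matrix (Fin m) (Fin n) ℂ}
    (h : frobSq (A + N) < frobSq N) : frobSq (t • A + N) < frobSq N := by
  have hconv : frobSq (t • A + N) ≤ t * frobSq (A + N) + (1 - t) * frobSq N := by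
    simp only [frobSq, Finset.mul_sum, ← Finset.sum_add_distrib]
    refine Finset.sum_le_sum fun i _ => Finset.sum_le_sum fun j _ => ?_
    simp only [Matrix.add_apply, Matrix.smul_apply, Complex.sq_norm, Complex.normSq_apply,
      Complex.add_re, Complex.add_im, Complex.real_smul, Complex.re_ofReal_mul,
      Complex.im_ofReal_mul]
    have : 0 ≤ t * (1 - t) * ((A i j).re ^ 2 + (A i j).im ^ 2) :=
      mul_nonneg (mul_nonneg ht0.le (by linarith)) (by positivity)
    linarith
  nlinarith

end Frob

/-- The pairs `(H, N)` for which the noise `N` favours a codeword `X'` over the sent codeword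
`X = X' + U`: with `Y = H X + N` this says `‖Y - H X'‖ < ‖Y - H X‖`. -/
def confusionEvent (nr : ℕ) {nt T : ℕ} (U : Matrix (Fin nt) (Fin T) ℂ) :
    Set ((Fin nr → Fin nt → ℂ) × (Fin nr → Fin T → ℂ)) :=
  {ω | frobSq (Matrix.of ω.1 * U + Matrix.of ω.2) < frobSq (Matrix.of ω.2)}

variable {nt T : ℕ}

lemma confusionEvent_smul_subset (nr : ℕ) {t : ℝ} (ht0 : 0 < t) (ht1 : t ≤ 1)
    (U : Matrix (Fin nt) (Fin T) ℂ) : confusionEvent nr U ⊆ confusionEvent nr (t • U) := by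
  intro ω hω
  rw [confusionEvent, Set.mem_ofPred_eq, Matrix.mul_smul]
  exact frobSq_smul_add_lt ht0 ht1 hω

/-- If the channel does not annihilate `U`, the noise `-H U` makes the receiver prefer the wrong
codeword. -/
lemma nonempty_confusionEvent {nr : ℕ} (hnr : 0 < nr) {U : Matrix (Fin nt) (Fin T) ℂ}
    (hU : U ≠ 0) : (confusionEvent nr U).Nonempty := by
  obtain ⟨i, j, hij⟩ : ∃ i j, U i j ≠ 0 := by
    by_contra! h
    exact hU (by ext i j; simpa using h i j)
  let H : Matrix (Fin nr) (Fin nt) ℂ := Matrix.single ⟨0, hnr⟩ i 1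
  have hHU : H * U ≠ 0 := by
    intro h
    have := congrFun (congrFun h ⟨0, hnr⟩) j
    simp [H] at this
    exact hij this
  refine ⟨(H, -(H * U)), ?_⟩
  change frobSq (H * U + -(H * U)) < frobSq (-(H * U))
  rw [add_neg_cancel, frobSq_neg, frobSq_eq_zero.2 rfl]
  exact frobSq_pos hHU

/-- Openness of the inequality defining `confusionEvent`, jointly in `U` and `(H, N)`, gives a
lower bound on its probability that is locally uniform in `U`. -/
lemma exists_nhds_le_measure_confusionEvent {nr : ℕ} (hnr : 0 < nr)
    {U : Matrix (Fin nt) (Fin T) ℂ} (hU : U ≠ 0) :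
    ∃ c > 0, ∀ᶠ U' in 𝓝 U,
      c ≤ ((gaussianMatrix nr nt).prod (gaussianMatrix nr T)).real (confusionEvent nr U') := by
  obtain ⟨ω, hω⟩ := nonempty_confusionEvent hnr hU
  have hopen : IsOpen {q : Matrix (Fin nt) (Fin T) ℂ ×
      ((Fin nr → Fin nt → ℂ) × (Fin nr → Fin T → ℂ)) | q.2 ∈ confusionEvent nr q.1} := by
    have hH : Continuous fun q : Matrix (Fin nt) (Fin T) ℂ ×
        ((Fin nr → Fin nt → ℂ) × (Fin nr → Fin T → ℂ)) =>
        (Matrix.of q.2.1 : Matrix (Fin nr) (Fin nt) ℂ) := continuous_snd.fst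
    have hN : Continuous fun q : Matrix (Fin nt) (Fin T) ℂ ×
        ((Fin nr → Fin nt → ℂ) × (Fin nr → Fin T → ℂ)) =>
        (Matrix.of q.2.2 : Matrix (Fin nr) (Fin T) ℂ) := continuous_snd.snd
    exact isOpen_lt (continuous_frobSq.comp ((hH.matrix_mul continuous_fst).add hN))
      (continuous_frobSq.comp hN)
  obtain ⟨A, B, hA, hB, hUA, hωB, hAB⟩ := isOpen_prod_iff.1 hopen U ω hω
  refine ⟨((gaussianMatrix nr nt).prod (gaussianMatrix nr T)).real B, ?_, ?_⟩
  · exact ENNReal.toReal_pos (hB.measure_pos _ ⟨ω, hωB⟩).ne' (measure_ne_top _ _)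
  · filter_upwards [hA.mem_nhds hUA] with U' hU'
    have hsub : B ⊆ confusionEvent nr U' := fun ω' hω' => by
      have h := hAB (Set.mk_mem_prod hU' hω')
      rwa [Set.mem_ofPred_eq] at h
    exact measureReal_mono hsub

/-- Two distinct codewords at Frobenius distance at most one are confused with a probability that
is bounded below independently of the codewords. By `confusionEvent_smul_subset` it suffices to
bound the probability on the unit sphere, which is compact. -/
lemma exists_le_measure_confusionEvent (nt T : ℕ) {nr : ℕ} (hnr : 0 < nr) :
    ∃ c > 0, ∀ U : Matrix (Fin nt) (Fin T) ℂ, U ≠ 0 → frobSq U ≤ 1 →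
      c ≤ ((gaussianMatrix nr nt).prod (gaussianMatrix nr T)).real (confusionEvent nr U) := by
  set μ := (gaussianMatrix nr nt).prod (gaussianMatrix nr T)
  obtain ⟨c, hc, h⟩ : ∃ c > 0, ∀ U ∈ {X : Matrix (Fin nt) (Fin T) ℂ | frobSq X = 1},
      c ≤ μ.real (confusionEvent nr U) := by
    refine isCompact_frobSq_eq_one.induction_on ⟨1, one_pos, by simp⟩ ?_ ?_ ?_
    · rintro s t hst ⟨c, hc, h⟩
      exact ⟨c, hc, fun U hU => h U (hst hU)⟩
    · rintro s t ⟨c, hc, h⟩ ⟨d, hd, h'⟩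
      refine ⟨min c d, lt_min hc hd, ?_⟩
      rintro U (hU | hU)
      · exact (min_le_left _ _).trans (h U hU)
      · exact (min_le_right _ _).trans (h' U hU)
    · intro U hU
      have hU0 : U ≠ 0 := by
        rintro rfl
        simp [frobSq] at hU
      obtain ⟨c, hc, h⟩ := exists_nhds_le_measure_confusionEvent hnr hU0
      exact ⟨_, mem_nhdsWithin_of_mem_nhds h, c, hc, fun U' hU' => hU'⟩
  refine ⟨c, hc, fun U hU hU1 => ?_⟩
  have hpos := frobSq_pos hU
  set t := √(frobSq U) with ht
  have ht0 : 0 < t := Real.sqrt_pos.2 hpos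
  have hsq : t ^ 2 = frobSq U := Real.sq_sqrt hpos.le
  have hsub := confusionEvent_smul_subset nr ht0 (Real.sqrt_le_one.2 hU1) (t⁻¹ • U)
  rw [smul_inv_smul₀ ht0.ne'] at hsub
  refine (h (t⁻¹ • U) ?_).trans (measureReal_mono hsub)
  rw [Set.mem_ofPred_eq, frobSq_smul, ← hsq]
  field_simp

lemma STBC.confusionEvent_subset_errorEvent (nr : ℕ) {C : STBC nt T}
    {X X' : Matrix (Fin nt) (Fin T) ℂ} (hX' : X' ∈ C) :
    confusionEvent nr (X - X') ⊆ C.errorEvent nr X := by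
  intro ω hω
  refine ⟨X', hX', ?_⟩
  have h1 : Matrix.of ω.1 * X + Matrix.of ω.2 - Matrix.of ω.1 * X' =
      Matrix.of ω.1 * (X - X') + Matrix.of ω.2 := by
    rw [Matrix.mul_sub]; abel
  rw [h1, add_sub_cancel_left]
  exact hω

lemma STBC.errorProb_le_one (nr : ℕ) (C : STBC nt T) : C.errorProb nr ≤ 1 := by
  refine div_le_one_of_le₀ ?_ (Nat.cast_nonneg _)
  refine (Finset.sum_le_card_nsmul _ _ 1 fun X _ => measureReal_le_one).trans ?_
  simp

/-! ### Sphere packing -/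

section Packing

open Metric Module

variable {E : Type*} [NormedAddCommGroup E] [NormedSpace ℝ E]

/-- The volumetric packing bound: the balls of radius `1/2` around the points of `s` are disjoint
and contained in the ball of radius `R + 1/2`. -/
lemma card_le_of_separated_of_norm_le [FiniteDimensional ℝ E] (s : Finset E) {R : ℝ}
    (hR : 0 ≤ R) (hs : ∀ x ∈ s, ‖x‖ ≤ R) (h : ∀ x ∈ s, ∀ y ∈ s, x ≠ y → 1 ≤ ‖x - y‖) :
    (s.card : ℝ) ≤ (1 + 2 * R) ^ finrank ℝ E := by
  borelize E
  let μ : Measure E := Measure.addHaar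
  have hdisj : (s : Set E).PairwiseDisjoint fun x => ball x (1 / 2 : ℝ) := by
    intro x hx y hy hxy
    apply ball_disjoint_ball
    rw [dist_eq_norm]
    linarith [h x hx y hy hxy]
  have hsub : (⋃ x ∈ s, ball x (1 / 2 : ℝ)) ⊆ ball (0 : E) (R + 1 / 2) := by
    refine Set.iUnion₂_subset fun x hx => ball_subset_ball' ?_
    rw [dist_zero_right]
    linarith [hs x hx]
  have hvol := measureReal_mono (μ := μ) hsub measure_ball_lt_top.ne
  rw [measureReal_biUnion_finset hdisj fun _ _ => measurableSet_ball] at hvol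
  have hball : ∀ (x : E) {r : ℝ}, 0 < r → μ.real (ball x r) = r ^ finrank ℝ E * μ.real (ball 0 1) :=
    fun x r hr => by
      rw [measureReal_def, μ.addHaar_ball_of_pos x hr, ENNReal.toReal_mul,
        ENNReal.toReal_ofReal (by positivity), measureReal_def]
  have hpos : 0 < μ.real (ball (0 : E) 1) :=
    ENNReal.toReal_pos (measure_ball_pos _ _ one_pos).ne' measure_ball_lt_top.ne
  simp only [hball _ (one_half_pos (α := ℝ)), Finset.sum_const, nsmul_eq_mul,
    hball (0 : E) (show 0 < R + 1 / 2 by linarith)] at hvol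
  rw [← mul_assoc, mul_le_mul_iff_left₀ hpos, one_div, inv_pow, ← div_eq_mul_inv,
    div_le_iff₀ (by positivity), ← mul_pow] at hvol
  rwa [show (R + 2⁻¹) * 2 = 1 + 2 * R by ring] at hvol

lemma card_le_of_separated_of_subset_submodule (V : Submodule ℝ E) [FiniteDimensional ℝ V]
    (s : Finset E) (hV : ∀ x ∈ s, x ∈ V) {R : ℝ} (hR : 0 ≤ R) (hs : ∀ x ∈ s, ‖x‖ ≤ R)
    (h : ∀ x ∈ s, ∀ y ∈ s, x ≠ y → 1 ≤ ‖x - y‖) :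
    (s.card : ℝ) ≤ (1 + 2 * R) ^ finrank ℝ V := by
  classical
  have hcard : (s.subtype (· ∈ V)).card = s.card := by
    rw [Finset.card_subtype, Finset.filter_true_of_mem hV]
  rw [← hcard]
  refine card_le_of_separated_of_norm_le (s.subtype (· ∈ V)) hR (fun x hx => ?_)
    fun x hx y hy hxy => ?_
  · exact hs x (Finset.mem_subtype.1 hx)
  · exact h x (Finset.mem_subtype.1 hx) y (Finset.mem_subtype.1 hy) fun e => hxy (Subtype.ext e)

open Classical in
/-- Of the points of `C`, at least half have at most twice the average energy `P`, and those among
them without a neighbour at distance less than one obey the packing bound. -/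
lemma half_card_sub_le_card_filter_neighbour (V : Submodule ℝ E) [FiniteDimensional ℝ V]
    (C : Finset E) (hV : ∀ x ∈ C, x ∈ V) {P : ℝ} (hP : 0 < P)
    (hC : ∑ x ∈ C, ‖x‖ ^ 2 ≤ P * C.card) :
    (C.card : ℝ) / 2 - (1 + 2 * √(2 * P)) ^ finrank ℝ V ≤
      (C.filter fun x => ∃ y ∈ C, x ≠ y ∧ ‖x - y‖ < 1).card := by
  set A := C.filter fun x => ∃ y ∈ C, x ≠ y ∧ ‖x - y‖ < 1
  set B := C.filter fun x => 2 * P < ‖x‖ ^ 2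
  set I := C.filter fun x => ¬ (∃ y ∈ C, x ≠ y ∧ ‖x - y‖ < 1) ∧ ‖x‖ ^ 2 ≤ 2 * P
  have hcover : C.card ≤ A.card + (B.card + I.card) := by
    refine (Finset.card_le_card (t := A ∪ (B ∪ I)) fun x hx => ?_).trans
      ((Finset.card_union_le _ _).trans (Nat.add_le_add_left (Finset.card_union_le _ _) _))
    simp only [A, B, I, Finset.mem_union, Finset.mem_filter, hx, true_and]
    by_cases h1 : ∃ y ∈ C, x ≠ y ∧ ‖x - y‖ < 1
    · exact Or.inl h1
    · rcases lt_or_ge (2 * P) (‖x‖ ^ 2) with h2 | h2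
      · exact Or.inr (Or.inl h2)
      · exact Or.inr (Or.inr ⟨h1, h2⟩)
  have hB : (B.card : ℝ) ≤ C.card / 2 := by
    have h1 : B.card * (2 * P) ≤ ∑ x ∈ B, ‖x‖ ^ 2 := by
      rw [← nsmul_eq_mul]
      exact Finset.card_nsmul_le_sum _ _ _ fun x hx => (Finset.mem_filter.1 hx).2.le
    have h2 : ∑ x ∈ B, ‖x‖ ^ 2 ≤ ∑ x ∈ C, ‖x‖ ^ 2 :=
      Finset.sum_le_sum_of_subset_of_nonneg (Finset.filter_subset _ _) fun _ _ _ => by positivity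
    rw [le_div_iff₀ two_pos]
    refine le_of_mul_le_mul_right ?_ hP
    linarith
  have hI : (I.card : ℝ) ≤ (1 + 2 * √(2 * P)) ^ finrank ℝ V := by
    refine card_le_of_separated_of_subset_submodule V I
      (fun x hx => hV x (Finset.mem_filter.1 hx).1) (Real.sqrt_nonneg _) (fun x hx => ?_)
      fun x hx y hy hxy => ?_
    · exact Real.le_sqrt_of_sq_le (Finset.mem_filter.1 hx).2.2
    · by_contra! hlt
      exact (Finset.mem_filter.1 hx).2.1 ⟨y, (Finset.mem_filter.1 hy).1, hxy, hlt⟩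
  have : (C.card : ℝ) ≤ A.card + (B.card + I.card) := by exact_mod_cast hcover
  linarith

end Packing

/-! ### Codes in a space of small dimension -/

section Code

attribute [local instance] Matrix.frobeniusNormedAddCommGroup Matrix.frobeniusNormedSpace

lemma frobenius_norm_sq {m n : ℕ} (X : Matrix (Fin m) (Fin n) ℂ) : ‖X‖ ^ 2 = frobSq X := by
  rw [Matrix.frobenius_norm_def, ← Real.sqrt_eq_rpow, Real.sq_sqrt (by positivity), frobSq]
  simp

open Classical in
/-- A code in a real subspace `V` of matrices whose cardinality exceeds the packing bound by a
factor of four has error probability bounded below: at least a quarter of the codewords have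
another codeword within distance one. -/
lemma STBC.exists_le_errorProb (nt T : ℕ) {nr : ℕ} (hnr : 0 < nr) :
    ∃ c > 0, ∀ (C : STBC nt T) (V : Submodule ℝ (Matrix (Fin nt) (Fin T) ℂ)) (P : ℝ),
      (∀ X ∈ C, X ∈ V) → 0 < P → 0 < C.card → C.avgEnergy ≤ P →
      4 * (1 + 2 * √(2 * P)) ^ Module.finrank ℝ V ≤ C.card → c ≤ C.errorProb nr := by
  obtain ⟨c, hc, h⟩ := exists_le_measure_confusionEvent nt T hnr
  refine ⟨c / 4, by positivity, fun C V P hV hP hC0 hE hcard => ?_⟩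
  have hC0' : (0 : ℝ) < C.card := by exact_mod_cast hC0
  rw [STBC.avgEnergy, div_le_iff₀ hC0'] at hE
  simp only [← frobenius_norm_sq] at hE
  set A := C.filter fun X => ∃ X' ∈ C, X ≠ X' ∧ ‖X - X'‖ < 1
  have hA : (C.card : ℝ) / 2 - (1 + 2 * √(2 * P)) ^ Module.finrank ℝ V ≤ A.card := by
    convert half_card_sub_le_card_filter_neighbour V C hV hP hE
  set μ := (gaussianMatrix nr nt).prod (gaussianMatrix nr T)
  have hsum : A.card * c ≤ ∑ X ∈ C, μ.real (C.errorEvent nr X) := by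
    rw [← nsmul_eq_mul]
    refine (Finset.card_nsmul_le_sum A (fun X => μ.real (C.errorEvent nr X)) c
      fun X hX => ?_).trans
      (Finset.sum_le_sum_of_subset_of_nonneg (Finset.filter_subset _ _)
        fun _ _ _ => measureReal_nonneg)
    obtain ⟨-, X', hX', hne, hlt⟩ := Finset.mem_filter.1 hX
    refine (h (X - X') (sub_ne_zero.2 hne) ?_).trans
      (measureReal_mono (STBC.confusionEvent_subset_errorEvent nr hX'))
    rw [← frobenius_norm_sq]
    exact pow_le_one₀ (norm_nonneg _) hlt.le
  rw [STBC.errorProb, le_div_iff₀ hC0']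
  refine le_trans ?_ hsum
  have : (C.card : ℝ) / 4 ≤ A.card := by linarith
  nlinarith

end Code

namespace LSTBC

/-- The real linear span of the weight matrices, which contains all codewords. -/
noncomputable def weightSpan (L : LSTBC nt T) : Submodule ℝ (Matrix (Fin nt) (Fin T) ℂ) :=
  Submodule.span ℝ (Set.range L.weight)

lemma mem_weightSpan_of_mem_code (L : LSTBC nt T) {X : Matrix (Fin nt) (Fin T) ℂ}
    (hX : X ∈ L.code) : X ∈ L.weightSpan := by
  classical
  simp only [code, Finset.mem_image] at hX
  obtain ⟨s, -, rfl⟩ := hX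
  refine Submodule.sum_mem _ fun j _ => ?_
  rw [Complex.coe_smul]
  exact Submodule.smul_mem _ _ (Submodule.subset_span ⟨j, rfl⟩)

lemma finrank_weightSpan (L : LSTBC nt T) :
    Module.finrank ℝ L.weightSpan = L.generator.rank := by
  let φ : Matrix (Fin nt) (Fin T) ℂ →ₗ[ℝ] ((Fin T × Fin nt) × Fin 2 → ℝ) :=
    { toFun := fun X => tilde (Matrix.vec X)
      map_add' := fun X Y => by
        ext ⟨q, e⟩
        fin_cases e <;> simp [tilde]
      map_smul' := fun t X => by
        ext ⟨q, e⟩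
        fin_cases e <;> simp [tilde] }
  have hφ : Function.Injective φ := by
    intro X Y hXY
    ext i j
    have h0 := congrFun hXY ((j, i), 0)
    have h1 := congrFun hXY ((j, i), 1)
    simp only [φ, LinearMap.coe_mk, AddHom.coe_mk, tilde] at h0 h1
    exact Complex.ext (by simpa [Matrix.vec] using h0) (by simpa [Matrix.vec] using h1)
  have hcols : Set.range L.generator.col = φ '' Set.range L.weight := by
    rw [← Set.range_comp]
    rfl
  rw [Matrix.rank_eq_finrank_span_cols, hcols, ← LinearMap.map_span]
  exact (Submodule.equivMapOfInjective φ hφ L.weightSpan).finrank_eq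

lemma codeRate_nonneg (L : LSTBC nt T) : 0 ≤ L.codeRate := by
  unfold codeRate; positivity

lemma finrank_weightSpan_eq_codeRate (hT : 0 < T) (L : LSTBC nt T) :
    (Module.finrank ℝ L.weightSpan : ℝ) = 2 * T * L.codeRate := by
  have : (0 : ℝ) < T := by exact_mod_cast hT
  rw [finrank_weightSpan, codeRate]
  field_simp

end LSTBC

/-! ### Multiplexing gain above the code-rate -/

lemma STBCScheme.HasMultiplexingGain.eventually_rpow_le_card (hT : 0 < T)
    {S : STBCScheme nt T} {r r' : ℝ} (hS : S.HasMultiplexingGain r) (hr : r' < r) :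
    ∀ᶠ snr in atTop, 0 < (S snr).card → snr ^ (r' * T) ≤ ((S snr).card : ℝ) := by
  have hT' : (0 : ℝ) < T := by exact_mod_cast hT
  filter_upwards [hS.eventually (lt_mem_nhds hr), eventually_gt_atTop 1] with snr h hsnr hcard
  have hlog : 0 < Real.logb 2 snr := Real.logb_pos one_lt_two hsnr
  rw [lt_div_iff₀ hlog, STBC.bitRate, lt_div_iff₀ hT'] at h
  have hcard' : (0 : ℝ) < (S snr).card := by exact_mod_cast hcard
  rw [← Real.logb_le_logb one_lt_two (by positivity) hcard', Real.logb_rpow_eq_mul_logb_of_pos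
    (by linarith)]
  linarith

lemma STBCScheme.HasMultiplexingGain.eventually_card_pos
    {S : STBCScheme nt T} {r : ℝ} (hS : S.HasMultiplexingGain r) (hr : 0 < r) :
    ∀ᶠ snr in atTop, 0 < (S snr).card := by
  filter_upwards [hS.eventually (lt_mem_nhds hr)] with snr h
  rw [Nat.pos_iff_ne_zero]
  intro h0
  simp [STBC.bitRate, h0] at h

lemma LSTBCScheme.IsRate.nonneg {L : LSTBCScheme nt T} {p : ℝ} (hL : L.IsRate p) : 0 ≤ p :=
  hL 1 one_pos ▸ (L 1).codeRate_nonneg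

/-- The packing bound for the span of the weight matrices grows like `SNR ^ (p T (1 + δ))`, with
`δ` arbitrarily small, and so is eventually dominated by `SNR ^ (r' T)`. -/
lemma LSTBCScheme.eventually_packing_le {L : LSTBCScheme nt T} {p r' : ℝ} (hT : 0 < T)
    (hL : L.IsRate p) (hr : p < r') :
    ∃ δ : ℝ, 0 < δ ∧ ∀ᶠ snr : ℝ in atTop, 4 * (1 + 2 * √(2 * snr ^ (1 + δ))) ^
      Module.finrank ℝ (L snr).weightSpan ≤ snr ^ (r' * T) := by
  have hT' : (0 : ℝ) < T := by exact_mod_cast hT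
  have hp := hL.nonneg
  set δ := (r' - p) / (p + 1) with hδ
  have hδ0 : 0 < δ := div_pos (by linarith) (by linarith)
  have hδp : δ * (p + 1) = r' - p := div_mul_cancel₀ _ (by linarith)
  -- the exponent left over is `T (r' - p (1 + δ)) = T δ`
  have hexp : r' * T = (1 + δ) / 2 * (2 * T * p) + δ * T := by
    rw [show r' = p + δ * (p + 1) by linarith]; ring
  refine ⟨δ, hδ0, ?_⟩
  filter_upwards [(tendsto_rpow_atTop (mul_pos hδ0 hT')).eventually_ge_atTop
    (4 * (4 : ℝ) ^ (2 * T * p)), eventually_ge_atTop 1] with snr h hsnr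
  have h0 : 0 < snr := by linarith
  set x := snr ^ ((1 + δ) / 2) with hx
  have hx1 : 1 ≤ x := Real.one_le_rpow hsnr (by linarith)
  have hxsq : snr ^ (1 + δ) = x ^ 2 := by
    rw [hx, ← Real.rpow_natCast, ← Real.rpow_mul h0.le]
    congr 1
    push_cast
    ring
  have hbase : 1 + 2 * √(2 * snr ^ (1 + δ)) ≤ 4 * x := by
    have : √(2 * snr ^ (1 + δ)) ≤ 3 / 2 * x := by
      rw [hxsq]
      refine Real.sqrt_le_iff.2 ⟨by positivity, by nlinarith⟩
    linarith
  calc 4 * (1 + 2 * √(2 * snr ^ (1 + δ))) ^ Module.finrank ℝ (L snr).weightSpan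
      ≤ 4 * (4 * x) ^ Module.finrank ℝ (L snr).weightSpan := by gcongr
    _ = 4 * 4 ^ (2 * T * p) * snr ^ ((1 + δ) / 2 * (2 * T * p)) := by
      rw [← Real.rpow_natCast, LSTBC.finrank_weightSpan_eq_codeRate hT, hL snr h0,
        Real.mul_rpow (by norm_num) (by positivity), hx, ← Real.rpow_mul h0.le]
      ring
    _ ≤ snr ^ (δ * T) * snr ^ ((1 + δ) / 2 * (2 * T * p)) := by gcongr
    _ = snr ^ (r' * T) := by rw [← Real.rpow_add h0, hexp, add_comm]

theorem LSTBCScheme.exists_le_errorProb {nr : ℕ} (hT : 0 < T) (hnr : 0 < nr)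
    {L : LSTBCScheme nt T} {p r : ℝ} (hL : L.IsRate p) (hP : L.toSTBCScheme.PowerConstraint)
    (hr : L.toSTBCScheme.HasMultiplexingGain r) (hpr : p < r) :
    ∃ c > 0, ∀ᶠ snr in atTop, c ≤ (L.toSTBCScheme snr).errorProb nr := by
  obtain ⟨r', hpr', hr'⟩ := exists_between hpr
  obtain ⟨δ, hδ, hpack⟩ := LSTBCScheme.eventually_packing_le hT hL hpr'
  obtain ⟨c, hc, h⟩ := STBC.exists_le_errorProb nt T hnr
  refine ⟨c, hc, ?_⟩
  filter_upwards [hpack, hP δ hδ, hr.eventually_rpow_le_card hT hr',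
    hr.eventually_card_pos (hL.nonneg.trans_lt hpr), eventually_gt_atTop 0]
    with snr h1 h2 h3 h4 h5
  exact h _ (L snr).weightSpan (snr ^ (1 + δ)) (fun X hX => (L snr).mem_weightSpan_of_mem_code hX)
    (by positivity) h4 h2 (h1.trans (h3 h4))

lemma STBCScheme.hasDiversityGain_zero {nr : ℕ} {S : STBCScheme nt T}
    (h : ∃ c > 0, ∀ᶠ snr in atTop, c ≤ (S snr).errorProb nr) : S.HasDiversityGain nr 0 := by
  obtain ⟨c, hc, h⟩ := h
  refine ⟨h.mono fun _ hx => hc.trans_le hx, ?_⟩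
  have hlim : Tendsto (fun snr => -(Real.logb 2 c / Real.logb 2 snr)) atTop (𝓝 0) := by
    simpa using ((Real.tendsto_logb_atTop one_lt_two).const_div_atTop (Real.logb 2 c)).neg
  refine tendsto_of_tendsto_of_tendsto_of_le_of_le' tendsto_const_nhds hlim ?_ ?_
  · filter_upwards [h, eventually_gt_atTop 1] with snr hx hsnr
    rw [le_neg, neg_zero]
    exact div_nonpos_of_nonpos_of_nonneg
      (Real.logb_nonpos one_lt_two (hc.le.trans hx) ((S snr).errorProb_le_one nr))
      (Real.logb_pos one_lt_two hsnr).le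
  · filter_upwards [h, eventually_gt_atTop 1] with snr hx hsnr
    have := Real.logb_pos one_lt_two hsnr
    have := Real.logb_le_logb_of_le one_lt_two hc hx
    gcongr

/-! ### The optimal curve -/

lemma optimalDMT_pos {nt nr : ℕ} {r : ℝ} (hr0 : 0 ≤ r) (hr : r < ((min nt nr : ℕ) : ℝ)) :
    0 < optimalDMT nt nr r := by
  have hk : ⌊r⌋₊ < min nt nr := (Nat.floor_lt hr0).2 hr
  have hle := Nat.floor_le hr0
  have hlt := Nat.lt_floor_add_one r
  set k := ⌊r⌋₊
  have h1 : (k : ℝ) + 1 ≤ nt := by exact_mod_cast hk.trans_le (min_le_left _ _)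
  have h2 : (k : ℝ) + 1 ≤ nr := by exact_mod_cast hk.trans_le (min_le_right _ _)
  have hd : 0 < dmtCorner nt nr k := mul_pos (by linarith) (by linarith)
  have hd' : 0 ≤ dmtCorner nt nr (k + 1) := by
    unfold dmtCorner
    push_cast
    exact mul_nonneg (by linarith) (by linarith)
  have : optimalDMT nt nr r =
      (1 - (r - k)) * dmtCorner nt nr k + (r - k) * dmtCorner nt nr (k + 1) := by
    unfold optimalDMT; ring
  rw [this]
  exact add_pos_of_pos_of_nonneg (mul_pos (by linarith) hd) (mul_nonneg (by linarith) hd')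

end MIMO

theorem mainTheorem2 (nt nr T : ℕ) (hT : 0 < T) (p : ℝ) (hp : p < ((min nt nr : ℕ) : ℝ)) :
    -- at every multiplexing gain above `p` the error probability is bounded away from zero,
    -- so that the diversity gain is zero, strictly below the optimal curve
    (∀ (L : MIMO.LSTBCScheme nt T) (r : ℝ), L.IsRate p → L.toSTBCScheme.PowerConstraint →
      L.toSTBCScheme.HasMultiplexingGain r → p < r →
        (∃ c > 0, ∀ᶠ snr in atTop, c ≤ (L.toSTBCScheme snr).errorProb nr) ∧
        L.toSTBCScheme.HasDiversityGain nr 0 ∧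
        (r < ((min nt nr : ℕ) : ℝ) → 0 < MIMO.optimalDMT nt nr r)) ∧
    -- no rate-`p` LSTBC-scheme is DMT-optimal
    (∀ S : ℝ → MIMO.LSTBCScheme nt T,
      (∀ r ∈ Set.Icc (0 : ℝ) ((min nt nr : ℕ) : ℝ),
        (S r).IsRate p ∧ (S r).toSTBCScheme.PowerConstraint) →
      ¬ MIMO.IsDMTOptimal nr fun r => (S r).toSTBCScheme) := by
  have main : ∀ (L : MIMO.LSTBCScheme nt T) (r : ℝ), L.IsRate p →
      L.toSTBCScheme.PowerConstraint → L.toSTBCScheme.HasMultiplexingGain r → p < r →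
        (∃ c > 0, ∀ᶠ snr in atTop, c ≤ (L.toSTBCScheme snr).errorProb nr) ∧
        L.toSTBCScheme.HasDiversityGain nr 0 ∧
        (r < ((min nt nr : ℕ) : ℝ) → 0 < MIMO.optimalDMT nt nr r) := by
    intro L r hL hP hr hpr
    have hmin : 0 < min nt nr := by exact_mod_cast hL.nonneg.trans_lt hp
    have h := L.exists_le_errorProb hT (hmin.trans_le (min_le_right _ _)) hL hP hr hpr
    exact ⟨h, MIMO.STBCScheme.hasDiversityGain_zero h,
      fun hlt => MIMO.optimalDMT_pos (hL.nonneg.trans hpr.le) hlt⟩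
  refine ⟨main, fun S hS hopt => ?_⟩
  have hp0 : 0 ≤ p := (hS 0 ⟨le_rfl, Nat.cast_nonneg _⟩).1.nonneg
  obtain ⟨r, hpr, hr⟩ := exists_between hp
  have hmem : r ∈ Set.Icc (0 : ℝ) ((min nt nr : ℕ) : ℝ) := ⟨hp0.trans hpr.le, hr.le⟩
  obtain ⟨hgain, -, hdiv⟩ := hopt r hmem
  obtain ⟨-, ⟨-, hzero⟩, hpos⟩ := main (S r) r (hS r hmem).1 (hS r hmem).2 hgain hpr
  exact (hpos hr).ne (tendsto_nhds_unique hzero hdiv)
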